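/- Let $d \in \mathbb{N}_0$ and let $\varepsilon \in \mathbb{R}$ (the semiclassical parameter). On Schwartz functions $\varphi \in \mathcal{S}(\mathbb{R}^d) \subset L^2(\mathbb{R}^d)$ let $(Q_l \varphi)(x) = x_l \varphi(x)$ and $(P_l \varphi)(x) = -i\varepsilon\, \partial_{x_l} \varphi(x)$, $l = 1, \dots, d$. For points $X = (x,\xi)$, $Y = (y,\eta)$ of the phase space $\mathbb{R}^d \times \mathbb{R}^d$ put $\sigma(X,Y) = \xi \cdot y - x \cdot \eta$, and let $\sigma(X,(Q,P)) = \xi \cdot Q - x \cdot P$ denote the closure in $L^2(\mathbb{R}^d)$ of the operator $\sum_l (\xi_l Q_l - x_l P_l)$ with domain $\mathcal{S}(\mathbb{R}^d)$. The Weyl system is $$W(X) := e^{-i \sigma(X,(Q,P))},$$ where $e^{-iA}$ is the value at $t = 1$ of the strongly continuous one-parameter unitary group $t \mapsto e^{-itA}$ with infinitesimal generator $A$, i.e. $A\varphi = \lim_{t \to 0} \frac{i}{t}\,(e^{-itA}\varphi - \varphi)$, the domain of $A$ being the set of all $\varphi$ for which this limit exists. Then: (0) For every $X$, the operator $\sigma(X,(Q,P))$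 is selfadjoint and is the generator of exactly one strongly continuous one-parameter unitary group, so that $W(X)$ is well defined. (1) For all $Y = (y,\eta)$ and $\varphi \in L^2(\mathbb{R}^d)$, for almost every $x \in \mathbb{R}^d$, $$\bigl(W(Y)\varphi\bigr)(x) = e^{-i \eta \cdot (x + \frac{\varepsilon}{2} y)}\, \varphi(x + \varepsilon y).$$ (2) The map $Y \mapsto W(Y)$ is strongly continuous: $Y \mapsto W(Y)\varphi$ is continuous for every $\varphi \in L^2(\mathbb{R}^d)$. (3) (Composition law.) For all $Y, Z \in \mathbb{R}^d \times \mathbb{R}^d$, $$W(Y)\, W(Z) = e^{i \frac{\varepsilon}{2} \sigma(Y,Z)}\, W(Y+Z).$$ -/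

import Mathlib

open MeasureTheory Filter Topology
open scoped SchwartzMap InnerProductSpace LineDeriv ENNReal

noncomputable section

namespace WeylCalculus

/-! ### One-parameter unitary groups and the exponential `e^{-iA}` -/

section Stone

variable {H : Type*} [NormedAddCommGroup H] [InnerProductSpace ℂ H]

/-- The difference quotient `(i / t) (U(t) φ - φ)`, whose limit for `t → 0` is `A φ` if
`U(t) = e^{-itA}`. -/
def generatorQuotient (U : ℝ → H →L[ℂ] H) (φ : H) (t : ℝ) : H :=
  (Complex.I / (t : ℂ)) • (U t φ - φ)

/-- The vectors on which the infinitesimal generator of `U` is defined. -/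
def generatorDomain (U : ℝ → H →L[ℂ] H) : Submodule ℂ H where
  carrier := {φ | ∃ ψ, Tendsto (generatorQuotient U φ) (𝓝[≠] 0) (𝓝 ψ)}
  zero_mem' := ⟨0, by
    have h : generatorQuotient U 0 = fun _ => 0 := by
      funext t; simp [generatorQuotient]
    rw [h]; exact tendsto_const_nhds⟩
  add_mem' := by
    rintro a b ⟨ψ, hψ⟩ ⟨χ, hχ⟩
    refine ⟨ψ + χ, (hψ.add hχ).congr fun t => ?_⟩
    simp only [generatorQuotient, map_add, ← smul_add]
    congr 1; abel
  smul_mem' := by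
    rintro c a ⟨ψ, hψ⟩
    refine ⟨c • ψ, (hψ.const_smul c).congr fun t => ?_⟩
    simp only [generatorQuotient, map_smul, ← smul_sub]
    rw [smul_comm]

/-- The infinitesimal generator `A` of `U(t) = e^{-itA}`: the operator
`A φ = lim_{t → 0} (i / t) (U(t) φ - φ)`, defined on all `φ` for which the limit exists. -/
def generator (U : ℝ → H →L[ℂ] H) : H →ₗ.[ℂ] H where
  domain := generatorDomain U
  toFun :=
    { toFun := fun φ => Classical.choose φ.2
      map_add' := fun a b => by
        refine tendsto_nhds_unique (Classical.choose_spec (a + b).2)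
          (((Classical.choose_spec a.2).add (Classical.choose_spec b.2)).congr fun t => ?_)
        simp only [generatorQuotient, Submodule.coe_add, map_add, ← smul_add]
        congr 1; abel
      map_smul' := fun c a => by
        refine tendsto_nhds_unique (Classical.choose_spec (c • a).2)
          (((Classical.choose_spec a.2).const_smul c).congr fun t => ?_)
        simp only [generatorQuotient, Submodule.coe_smul, map_smul, ← smul_sub]
        rw [smul_comm] }

theorem tendsto_generator (U : ℝ → H →L[ℂ] H) (φ : (generator U).domain) :
    Tendsto (generatorQuotient U (φ : H)) (𝓝[≠] 0) (𝓝 (generator U φ)) :=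
  Classical.choose_spec φ.2

variable [CompleteSpace H]

/-- `U` is a strongly continuous one-parameter unitary group with infinitesimal generator `A`,
that is, `U(t) = e^{-itA}`. -/
structure IsUnitaryGroupGeneratedBy (A : H →ₗ.[ℂ] H) (U : ℝ → H →L[ℂ] H) : Prop where
  map_zero : U 0 = 1
  map_add : ∀ s t, U (s + t) = U s * U t
  mem_unitary : ∀ t, U t ∈ unitary (H →L[ℂ] H)
  strongly_continuous : ∀ φ, Continuous fun t => U t φ
  generator_eq : generator U = A

open Classical in
/-- The exponential `e^{-iA}` of a selfadjoint (in general unbounded) operator `A`: the value at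
time `1` of the strongly continuous one-parameter unitary group generated by `A`
(and `0` if `A` generates no such group). -/
def expNegI (A : H →ₗ.[ℂ] H) : H →L[ℂ] H :=
  if h : ∃ U, IsUnitaryGroupGeneratedBy A U then Classical.choose h 1 else 0

end Stone

/-! ### Position, momentum and the Weyl system -/

/-- Configuration space `ℝ^d`. -/
abbrev Config (d : ℕ) : Type := EuclideanSpace ℝ (Fin d)

/-- Phase space `ℝ^d × ℝ^d`, with points `X = (x, ξ)`. -/
abbrev PhaseSpace (d : ℕ) : Type := Config d × Config d

/-- The Hilbert space `L²(ℝ^d)`. -/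
abbrev L2 (d : ℕ) : Type := Lp ℂ 2 (volume : Measure (Config d))

/-- The symplectic form `σ(X, Y) = ξ · y - x · η`. -/
def sympl {d : ℕ} (X Y : PhaseSpace d) : ℝ := ⟪X.2, Y.1⟫_ℝ - ⟪X.1, Y.2⟫_ℝ

/-- The `l`-th component of position, `(Q_l φ)(x) = x_l φ(x)`, on Schwartz functions. -/
def position {d : ℕ} (l : Fin d) : 𝓢(Config d, ℂ) →ₗ[ℂ] 𝓢(Config d, ℂ) :=
  (SchwartzMap.smulLeftCLM ℂ (fun x : Config d => ((x l : ℝ) : ℂ))).toLinearMap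

theorem position_apply {d : ℕ} (l : Fin d) (φ : 𝓢(Config d, ℂ)) (x : Config d) :
    position l φ x = ((x l : ℝ) : ℂ) * φ x := by
  have h : (fun x : Config d => ((x l : ℝ) : ℂ)).HasTemperateGrowth :=
    (Complex.ofRealCLM.comp
      (EuclideanSpace.proj l : Config d →L[ℝ] ℝ)).hasTemperateGrowth
  simp [position, SchwartzMap.smulLeftCLM_apply_apply h]

/-- The `l`-th component of momentum, `(P_l φ)(x) = -i ε ∂_l φ(x)`, on Schwartz functions. -/
def momentum {d : ℕ} (ε : ℝ) (l : Fin d) : 𝓢(Config d, ℂ) →ₗ[ℂ] 𝓢(Config d, ℂ) :=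
  (-Complex.I * (ε : ℂ)) •
    (LineDeriv.lineDerivOpCLM ℂ 𝓢(Config d, ℂ) (EuclideanSpace.single l (1 : ℝ))).toLinearMap

theorem momentum_apply {d : ℕ} (ε : ℝ) (l : Fin d) (φ : 𝓢(Config d, ℂ)) (x : Config d) :
    momentum ε l φ x = -Complex.I * (ε : ℂ) *
      fderiv ℝ φ x (EuclideanSpace.single l (1 : ℝ)) := by
  simp [momentum, SchwartzMap.lineDerivOp_apply_eq_fderiv]

/-- The operator `σ(X, (Q, P)) = ξ · Q - x · P` on Schwartz functions, for `X = (x, ξ)`. -/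
def symplQP {d : ℕ} (ε : ℝ) (X : PhaseSpace d) : 𝓢(Config d, ℂ) →ₗ[ℂ] 𝓢(Config d, ℂ) :=
  ∑ l, ((X.2 l : ℂ) • position l - (X.1 l : ℂ) • momentum ε l)

/-- The inclusion of the Schwartz functions into `L²(ℝ^d)`. -/
def schwartzToL2 (d : ℕ) : 𝓢(Config d, ℂ) →ₗ[ℂ] L2 d :=
  (SchwartzMap.toLpCLM ℂ ℂ 2 (volume : Measure (Config d))).toLinearMap

theorem schwartzToL2_injective (d : ℕ) : Function.Injective (schwartzToL2 d) :=
  SchwartzMap.injective_toLp 2 (volume : Measure (Config d))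

/-- A linear operator on Schwartz functions, seen as an unbounded operator on `L²(ℝ^d)` with
domain the Schwartz functions. -/
def onSchwartz {d : ℕ} (T : 𝓢(Config d, ℂ) →ₗ[ℂ] 𝓢(Config d, ℂ)) : L2 d →ₗ.[ℂ] L2 d where
  domain := LinearMap.range (schwartzToL2 d)
  toFun := schwartzToL2 d ∘ₗ T ∘ₗ
    (LinearEquiv.ofInjective (schwartzToL2 d) (schwartzToL2_injective d)).symm.toLinearMap

theorem onSchwartz_apply {d : ℕ} (T : 𝓢(Config d, ℂ) →ₗ[ℂ] 𝓢(Config d, ℂ))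
    (φ : 𝓢(Config d, ℂ)) :
    onSchwartz T ⟨schwartzToL2 d φ, LinearMap.mem_range_self _ φ⟩ = schwartzToL2 d (T φ) := by
  have h : (LinearEquiv.ofInjective (schwartzToL2 d) (schwartzToL2_injective d)).symm
      ⟨schwartzToL2 d φ, LinearMap.mem_range_self _ φ⟩ = φ := by
    rw [LinearEquiv.symm_apply_eq]; rfl
  change schwartzToL2 d (T _) = _
  exact congrArg (fun χ => schwartzToL2 d (T χ)) h

/-- The operator `σ(X, (Q, P)) = ξ · Q - x · P` on `L²(ℝ^d)`: the closure of its restriction to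
the Schwartz functions. -/
def weylGenerator {d : ℕ} (ε : ℝ) (X : PhaseSpace d) : L2 d →ₗ.[ℂ] L2 d :=
  (onSchwartz (symplQP ε X)).closure

/-- The Weyl system `W(X) = e^{-iσ(X, (Q, P))} = e^{-i(ξ · Q - x · P)}`. -/
def weylSystem {d : ℕ} (ε : ℝ) (X : PhaseSpace d) : L2 d →L[ℂ] L2 d :=
  expNegI (weylGenerator ε X)

end WeylCalculus

end

noncomputable section

namespace WeylCalculus

/-! ### Unitary groups: generators, cores and uniqueness. -/

section UnitaryGroups

open scoped LinearPMap

variable {H : Type*} [NormedAddCommGroup H] [InnerProductSpace ℂ H]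

/-! The group is known in advance, so Stone's theorem is not needed. The explicit formula for the
Weyl translates defines isometries `weylOperator ε Y`, and multiplying two of them produces the
phase exp(i(ε/2)σ(Y,Z)). Since σ(sY,tY) = 0, t ↦ `weylOperator ε (t • Y)` is a unitary group, and
differentiating it at 0 on Schwartz functions gives -iσ(Y,(Q,P))
(`tendsto_generatorQuotient_weylOperator`).

That its generator is exactly the closure is Nelson's core criterion: the Schwartz space is dense
and invariant under the group. If T is the restriction of the generator to such a space and (a,b) in
the graph of T† is orthogonal to the graph of T, then t ↦ ⟪U t φ, a⟫ ± i⟪U t φ, b⟫ solves f' = ±f.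
Unitarity bounds f on all of ℝ, so f = 0, and density gives a = b = 0. Hence T† = T.closure
(`adjoint_eq_closure`), which is the generator and is selfadjoint.

A densely defined operator generates at most one group (`IsUnitaryGroupGeneratedBy.unique`), so W(Y)
is the explicit operator. The action and the composition law are then read off; strong continuity
follows by dominated convergence on Schwartz functions and density. -/

theorem eq_zero_of_hasDerivAt_mul_self_of_bounded {c : ℝ} (hc : c ≠ 0) {f : ℝ → ℂ} {M : ℝ}
    (hf : ∀ t, HasDerivAt f (c * f t) t) (hb : ∀ t, ‖f t‖ ≤ M) : f 0 = 0 := by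
  have hexp : ∀ t : ℝ, HasDerivAt (fun s : ℝ => Complex.exp (-c * s))
      (Complex.exp (-c * t) * (-c * 1)) t := fun t =>
    ((hasDerivAt_id (t : ℂ)).const_mul (-c : ℂ)).cexp.comp_ofReal
  have hd : ∀ t, HasDerivAt (fun s : ℝ => Complex.exp (-c * s) * f s) 0 t := fun t =>
    ((hexp t).mul (hf t)).congr_deriv (by ring)
  have hconst : ∀ t : ℝ, f 0 = Complex.exp (-c * t) * f t := fun t => by
    simpa using is_const_of_deriv_eq_zero (fun s => (hd s).differentiableAt)
      (fun s => (hd s).deriv) 0 t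
  -- Evaluating at t = s / c makes the exponential e^{-s} for either sign of c.
  have hle : ∀ s : ℝ, ‖f 0‖ ≤ Real.exp (-s) * M := fun s => by
    rw [hconst (s / c), norm_mul, Complex.norm_exp]
    have : (-c * ((s / c : ℝ) : ℂ)).re = -s := by
      rw [← Complex.ofReal_neg, ← Complex.ofReal_mul, Complex.ofReal_re]
      field_simp
    rw [this]
    gcongr
    exact hb _
  have hlim : Tendsto (fun s : ℝ => Real.exp (-s) * M) atTop (𝓝 0) := by
    simpa using Real.tendsto_exp_neg_atTop_nhds_zero.mul_const M
  exact norm_le_zero_iff.1 (ge_of_tendsto' hlim hle)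

theorem generator_apply_eq {U : ℝ → H →L[ℂ] H} {φ : (generator U).domain} {ψ : H}
    (h : Tendsto (generatorQuotient U (φ : H)) (𝓝[≠] 0) (𝓝 ψ)) : generator U φ = ψ :=
  tendsto_nhds_unique (tendsto_generator U φ) h

theorem mem_graph_generator_iff {U : ℝ → H →L[ℂ] H} {φ ψ : H} :
    (φ, ψ) ∈ (generator U).graph ↔ Tendsto (generatorQuotient U φ) (𝓝[≠] 0) (𝓝 ψ) := by
  rw [LinearPMap.mem_graph_iff]
  constructor
  · rintro ⟨y, rfl, rfl⟩
    exact tendsto_generator U y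
  · exact fun h => ⟨⟨φ, ψ, h⟩, rfl, generator_apply_eq h⟩

variable [CompleteSpace H]

/-- A one-parameter group of unitary operators, without any continuity assumption. -/
structure IsUnitaryGroup (U : ℝ → H →L[ℂ] H) : Prop where
  map_zero : U 0 = 1
  map_add : ∀ s t, U (s + t) = U s * U t
  mem_unitary : ∀ t, U t ∈ unitary (H →L[ℂ] H)

namespace IsUnitaryGroup

variable {U : ℝ → H →L[ℂ] H} (hU : IsUnitaryGroup U)

include hU

theorem inner_map_map (t : ℝ) (φ χ : H) : ⟪U t φ, U t χ⟫_ℂ = ⟪φ, χ⟫_ℂ := by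
  rw [← ContinuousLinearMap.adjoint_inner_right, ← ContinuousLinearMap.star_eq_adjoint,
    ← mul_apply_eq_comp, (Unitary.mem_iff.1 (hU.mem_unitary t)).1]
  rfl

theorem norm_map (t : ℝ) (φ : H) : ‖U t φ‖ = ‖φ‖ := by
  rw [@norm_eq_sqrt_re_inner ℂ, hU.inner_map_map, ← @norm_eq_sqrt_re_inner ℂ]

theorem generatorQuotient_map (s : ℝ) (φ : H) (t : ℝ) :
    generatorQuotient U (U s φ) t = U s (generatorQuotient U φ t) := by
  rw [generatorQuotient, generatorQuotient, map_smul, map_sub, ← mul_apply_eq_comp,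
    ← mul_apply_eq_comp, ← hU.map_add, ← hU.map_add, add_comm]

theorem tendsto_generatorQuotient_map {φ ψ : H}
    (h : Tendsto (generatorQuotient U φ) (𝓝[≠] 0) (𝓝 ψ)) (s : ℝ) :
    Tendsto (generatorQuotient U (U s φ)) (𝓝[≠] 0) (𝓝 (U s ψ)) :=
  (((U s).continuous.tendsto ψ).comp h).congr fun t => (hU.generatorQuotient_map s φ t).symm

theorem tendsto_generatorQuotient_iff_hasDerivAt {φ ψ : H} :
    Tendsto (generatorQuotient U φ) (𝓝[≠] 0) (𝓝 ψ) ↔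
      HasDerivAt (fun t => U t φ) (-Complex.I • ψ) 0 := by
  have key : ∀ t : ℝ, t⁻¹ • (U (0 + t) φ - U 0 φ) = -Complex.I • generatorQuotient U φ t := by
    intro t
    rw [generatorQuotient, smul_smul, zero_add, hU.map_zero, one_apply_eq_self,
      RCLike.real_smul_eq_coe_smul (K := ℂ)]
    congr 1
    simp [div_eq_mul_inv, ← mul_assoc]
  rw [hasDerivAt_iff_tendsto_slope_zero]
  simp only [key]
  constructor
  · exact fun h => h.const_smul _
  · intro h
    simpa [smul_smul] using h.const_smul Complex.I

theorem hasDerivAt {φ ψ : H} (h : Tendsto (generatorQuotient U φ) (𝓝[≠] 0) (𝓝 ψ)) (t : ℝ) :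
    HasDerivAt (fun s => U s φ) (-Complex.I • U t ψ) t := by
  have h0 := (hU.tendsto_generatorQuotient_iff_hasDerivAt.1
    (hU.tendsto_generatorQuotient_map h t))
  have h1 : HasDerivAt (fun s => U s (U t φ)) (-Complex.I • U t ψ) (t - t) := by
    rwa [sub_self]
  refine (h1.comp_sub_const t t).congr_of_eventuallyEq (Eventually.of_forall fun s => ?_)
  change U s φ = U (s - t) (U t φ)
  rw [← mul_apply_eq_comp, ← hU.map_add, sub_add_cancel]

/-- Differentiate the constant function t ↦ ⟪U t φ, U t φ'⟫ at 0. -/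
theorem inner_generator_symm {φ ψ φ' ψ' : H}
    (h : Tendsto (generatorQuotient U φ) (𝓝[≠] 0) (𝓝 ψ))
    (h' : Tendsto (generatorQuotient U φ') (𝓝[≠] 0) (𝓝 ψ')) :
    ⟪ψ, φ'⟫_ℂ = ⟪φ, ψ'⟫_ℂ := by
  have hd := (hU.hasDerivAt h 0).inner ℂ (hU.hasDerivAt h' 0)
  simp only [hU.inner_map_map, hU.map_zero, one_apply_eq_self] at hd
  have h0 := hd.unique (hasDerivAt_const (0 : ℝ) ⟪φ, φ'⟫_ℂ)
  simp only [inner_smul_left, inner_smul_right, map_neg, Complex.conj_I, neg_neg] at h0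
  refine mul_left_cancel₀ Complex.I_ne_zero ?_
  linear_combination h0

theorem generator_isFormalAdjoint {T : H →ₗ.[ℂ] H}
    (hT : ∀ φ : T.domain, Tendsto (generatorQuotient U (φ : H)) (𝓝[≠] 0) (𝓝 (T φ))) :
    T.IsFormalAdjoint (generator U) := fun φ χ =>
  hU.inner_generator_symm (hT φ) (tendsto_generator U χ)

theorem isClosed_generator : (generator U).IsClosed := by
  refine isClosed_of_closure_subset fun p hp => ?_
  obtain ⟨q, hq, hlim⟩ := mem_closure_iff_seq_limit.1 hp
  have hq' : ∀ n, Tendsto (generatorQuotient U (q n).1) (𝓝[≠] 0) (𝓝 (q n).2) := fun n =>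
    mem_graph_generator_iff.1 (hq n)
  have h1 : Tendsto (fun n => (q n).1) atTop (𝓝 p.1) := (continuous_fst.tendsto p).comp hlim
  have h2 : Tendsto (fun n => (q n).2) atTop (𝓝 p.2) := (continuous_snd.tendsto p).comp hlim
  refine mem_graph_generator_iff.2 (hU.tendsto_generatorQuotient_iff_hasDerivAt.2 ?_)
  -- Each U t is an isometry, so the derivatives converge uniformly in t and the limit may be
  -- differentiated.
  have hunif : TendstoUniformly (fun n t => -Complex.I • U t (q n).2)
      (fun t => -Complex.I • U t p.2) atTop := by
    rw [Metric.tendstoUniformly_iff]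
    intro ε hε
    filter_upwards [Metric.tendsto_nhds.1 h2 ε hε] with n hn t
    rw [dist_eq_norm, ← smul_sub, ← map_sub, norm_smul, hU.norm_map, ← dist_eq_norm, dist_comm]
    simpa using hn
  have := hasDerivAt_of_tendstoUniformly hunif
    (Eventually.of_forall fun n t => hU.hasDerivAt (hq' n) t)
    (fun t => ((U t).continuous.tendsto _).comp h1) 0
  simpa [hU.map_zero] using this

/-- A symmetric restriction of the generator to a dense invariant subspace has no deficiency:
the orthogonal complement of its graph inside the graph of its adjoint is trivial. -/
theorem eq_zero_of_deficiency {T : H →ₗ.[ℂ] H} (hdense : Dense (T.domain : Set H))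
    (hT : ∀ φ : T.domain, Tendsto (generatorQuotient U (φ : H)) (𝓝[≠] 0) (𝓝 (T φ)))
    (hinv : ∀ t, ∀ φ ∈ T.domain, U t φ ∈ T.domain) {a b : H}
    (hadj : ∀ φ : T.domain, ⟪T φ, a⟫_ℂ = ⟪(φ : H), b⟫_ℂ)
    (horth : ∀ φ : T.domain, ⟪(φ : H), a⟫_ℂ + ⟪T φ, b⟫_ℂ = 0) : a = 0 ∧ b = 0 := by
  have hTU : ∀ (φ : T.domain) t, U t (T φ) = T ⟨U t φ, hinv t φ φ.2⟩ := fun φ t =>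
    tendsto_nhds_unique (hU.tendsto_generatorQuotient_map (hT φ) t) (hT ⟨U t φ, hinv t φ φ.2⟩)
  have hd : ∀ (φ : T.domain) (c : H) t, HasDerivAt (fun s => ⟪U s φ, c⟫_ℂ)
      (Complex.I * ⟪T ⟨U t φ, hinv t φ φ.2⟩, c⟫_ℂ) t := fun φ c t => by
    have := (hU.hasDerivAt (hT φ) t).inner ℂ (hasDerivAt_const t c)
    simpa [inner_smul_left, hTU] using this
  have hbd : ∀ (φ : T.domain) (c : H) t, ‖⟪U t φ, c⟫_ℂ‖ ≤ ‖(φ : H)‖ * ‖c‖ := fun φ c t =>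
    (norm_inner_le_norm _ _).trans_eq (by rw [hU.norm_map])
  -- The hypotheses say T†a = b and T†b = -a; invariance of the domain lets them be applied at U t
  -- φ.
  have hda : ∀ (φ : T.domain) t, HasDerivAt (fun s => ⟪U s φ, a⟫_ℂ)
      (Complex.I * ⟪U t φ, b⟫_ℂ) t := fun φ t => by
    simpa [hadj] using hd φ a t
  have hdb : ∀ (φ : T.domain) t, HasDerivAt (fun s => ⟪U s φ, b⟫_ℂ)
      (-Complex.I * ⟪U t φ, a⟫_ℂ) t := fun φ t => by
    refine (hd φ b t).congr_deriv ?_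
    linear_combination Complex.I * horth ⟨U t φ, hinv t φ φ.2⟩
  have hplus : ∀ φ : T.domain, ⟪(φ : H), a⟫_ℂ + Complex.I * ⟪(φ : H), b⟫_ℂ = 0 := fun φ => by
    have := eq_zero_of_hasDerivAt_mul_self_of_bounded (c := 1) one_ne_zero
      (f := fun s => ⟪U s φ, a⟫_ℂ + Complex.I * ⟪U s φ, b⟫_ℂ)
      (M := ‖(φ : H)‖ * ‖a‖ + ‖(φ : H)‖ * ‖b‖)
      (fun t => ((hda φ t).add ((hdb φ t).const_mul Complex.I)).congr_deriv (by
        push_cast; linear_combination -⟪U t φ, a⟫_ℂ * Complex.I_mul_I))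
      (fun t => (norm_add_le _ _).trans (add_le_add (hbd φ a t) (by simpa using hbd φ b t)))
    simpa [hU.map_zero] using this
  have hminus : ∀ φ : T.domain, ⟪(φ : H), a⟫_ℂ - Complex.I * ⟪(φ : H), b⟫_ℂ = 0 := fun φ => by
    have := eq_zero_of_hasDerivAt_mul_self_of_bounded (c := -1) (by norm_num)
      (f := fun s => ⟪U s φ, a⟫_ℂ - Complex.I * ⟪U s φ, b⟫_ℂ)
      (M := ‖(φ : H)‖ * ‖a‖ + ‖(φ : H)‖ * ‖b‖)
      (fun t => ((hda φ t).sub ((hdb φ t).const_mul Complex.I)).congr_deriv (by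
        push_cast; linear_combination ⟪U t φ, a⟫_ℂ * Complex.I_mul_I))
      (fun t => (norm_sub_le _ _).trans (add_le_add (hbd φ a t) (by simpa using hbd φ b t)))
    simpa [hU.map_zero] using this
  constructor
  · refine hdense.eq_zero_of_inner_right ℂ fun φ hφ => ?_
    linear_combination (1 / 2 : ℂ) * hplus ⟨φ, hφ⟩ + (1 / 2 : ℂ) * hminus ⟨φ, hφ⟩
  · refine hdense.eq_zero_of_inner_right ℂ fun φ hφ => ?_
    refine mul_left_cancel₀ Complex.I_ne_zero ?_
    linear_combination (1 / 2 : ℂ) * hplus ⟨φ, hφ⟩ - (1 / 2 : ℂ) * hminus ⟨φ, hφ⟩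

theorem le_adjoint_of_tendsto {T : H →ₗ.[ℂ] H} (hdense : Dense (T.domain : Set H))
    (hT : ∀ φ : T.domain, Tendsto (generatorQuotient U (φ : H)) (𝓝[≠] 0) (𝓝 (T φ))) :
    T ≤ T† :=
  LinearPMap.IsFormalAdjoint.le_adjoint hdense fun φ χ => hU.inner_generator_symm (hT φ) (hT χ)

/-- The graph of T† contains the closed graph of T.closure; the orthogonal component of any element
of the former is a deficiency pair, hence zero. -/
theorem adjoint_eq_closure {T : H →ₗ.[ℂ] H} (hdense : Dense (T.domain : Set H))
    (hT : ∀ φ : T.domain, Tendsto (generatorQuotient U (φ : H)) (𝓝[≠] 0) (𝓝 (T φ)))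
    (hinv : ∀ t, ∀ φ ∈ T.domain, U t φ ∈ T.domain) : T† = T.closure := by
  have hle := hU.le_adjoint_of_tendsto hdense hT
  have hcl : T†.IsClosed := LinearPMap.adjoint_isClosed hdense
  have hclos : T.IsClosable := hcl.isClosable.leIsClosable hle
  refine LinearPMap.eq_of_eq_graph ?_
  rw [← hclos.graph_closure_eq_closure_graph]
  refine le_antisymm ?_ (Submodule.topologicalClosure_minimal _ (LinearPMap.le_graph_of_le hle) hcl)
  -- `H × H` carries the sup norm; orthogonal projection needs the Hilbert norm of `WithLp 2`.
  let e : (H × H) ≃L[ℂ] WithLp 2 (H × H) := (WithLp.prodContinuousLinearEquiv 2 ℂ H H).symm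
  let G : Submodule ℂ (WithLp 2 (H × H)) :=
    T.graph.topologicalClosure.map e.toLinearEquiv.toLinearMap
  have hG : IsClosed (G : Set (WithLp 2 (H × H))) := by
    have : (G : Set (WithLp 2 (H × H))) = e '' (T.graph.topologicalClosure : Set (H × H)) := rfl
    rw [this]
    exact e.toHomeomorph.isClosedMap _ T.graph.isClosed_topologicalClosure
  have : CompleteSpace G := hG.completeSpace_coe
  rintro p hp
  obtain ⟨g, hg, n, hn, hgn⟩ := G.exists_add_mem_mem_orthogonal (e p)
  obtain ⟨g', hg', rfl⟩ := hg
  have hg'' : g' ∈ T†.graph :=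
    Submodule.topologicalClosure_minimal _ (LinearPMap.le_graph_of_le hle) hcl hg'
  have hn' : e.symm n ∈ T†.graph := by
    have : e.symm n = p - g' := by
      rw [ContinuousLinearEquiv.symm_apply_eq, map_sub, hgn]
      exact (add_sub_cancel_left _ _).symm
    rw [this]
    exact sub_mem hp hg''
  have hzero := hU.eq_zero_of_deficiency hdense hT hinv (a := (e.symm n).1) (b := (e.symm n).2)
    (fun φ => by
      rw [LinearPMap.adjoint_graph_eq_graph_adjoint hdense, Submodule.mem_adjoint_iff] at hn'
      exact sub_eq_zero.1 (hn' φ (T φ) (T.mem_graph φ)))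
    (fun φ => by
      have := (Submodule.mem_orthogonal _ _).1 hn (e (φ, T φ))
        ⟨_, T.graph.le_topologicalClosure (T.mem_graph φ), rfl⟩
      rwa [WithLp.prod_inner_apply] at this)
  have hn0 : n = 0 := by
    have : e.symm n = 0 := Prod.ext hzero.1 hzero.2
    simpa using this
  rw [hn0, add_zero] at hgn
  rwa [← e.injective hgn.symm]

/-- The generator is closed and extends T, so it contains the closure; by symmetry it lies in T†,
which is the closure. -/
theorem generator_eq_closure {T : H →ₗ.[ℂ] H} (hdense : Dense (T.domain : Set H))
    (hT : ∀ φ : T.domain, Tendsto (generatorQuotient U (φ : H)) (𝓝[≠] 0) (𝓝 (T φ)))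
    (hinv : ∀ t, ∀ φ ∈ T.domain, U t φ ∈ T.domain) : generator U = T.closure := by
  have hle : T ≤ generator U := LinearPMap.le_of_le_graph fun p hp => by
    obtain ⟨φ, hφ, hφ'⟩ := (LinearPMap.mem_graph_iff _).1 hp
    refine mem_graph_generator_iff.2 ?_
    rw [← hφ, ← hφ']
    exact hT φ
  refine le_antisymm ?_ ?_
  · rw [← hU.adjoint_eq_closure hdense hT hinv]
    exact (hU.generator_isFormalAdjoint hT).le_adjoint hdense
  · have hcl := hU.isClosed_generator
    refine LinearPMap.le_of_le_graph ?_
    rw [← (hcl.isClosable.leIsClosable hle).graph_closure_eq_closure_graph]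
    exact Submodule.topologicalClosure_minimal _ (LinearPMap.le_graph_of_le hle) hcl

/-- The core criterion applies a second time, to the generator itself, whose domain is invariant
under the group: its adjoint is its closure, and it is closed. -/
theorem isSelfAdjoint_closure {T : H →ₗ.[ℂ] H} (hdense : Dense (T.domain : Set H))
    (hT : ∀ φ : T.domain, Tendsto (generatorQuotient U (φ : H)) (𝓝[≠] 0) (𝓝 (T φ)))
    (hinv : ∀ t, ∀ φ ∈ T.domain, U t φ ∈ T.domain) : IsSelfAdjoint T.closure := by
  have hgen := hU.generator_eq_closure hdense hT hinv
  have hdense' : Dense ((generator U).domain : Set H) :=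
    hdense.mono (hgen ▸ T.le_closure.1)
  rw [LinearPMap.isSelfAdjoint_def, ← hgen,
    hU.adjoint_eq_closure hdense' (tendsto_generator U)
      fun t φ hφ => ⟨_, hU.tendsto_generatorQuotient_map hφ.choose_spec t⟩]
  have hcl := hU.isClosed_generator
  refine LinearPMap.eq_of_eq_graph ?_
  rw [← hcl.isClosable.graph_closure_eq_closure_graph]
  exact hcl.submodule_topologicalClosure_eq

end IsUnitaryGroup

theorem IsUnitaryGroupGeneratedBy.isUnitaryGroup {A : H →ₗ.[ℂ] H} {U : ℝ → H →L[ℂ] H}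
    (h : IsUnitaryGroupGeneratedBy A U) : IsUnitaryGroup U :=
  ⟨h.map_zero, h.map_add, h.mem_unitary⟩

theorem IsUnitaryGroupGeneratedBy.unique {A : H →ₗ.[ℂ] H} (hA : Dense (A.domain : Set H))
    {U V : ℝ → H →L[ℂ] H} (hU : IsUnitaryGroupGeneratedBy A U)
    (hV : IsUnitaryGroupGeneratedBy A V) : U = V := by
  have gU := hU.isUnitaryGroup
  have gV := hV.isUnitaryGroup
  have hlim : ∀ {W : ℝ → H →L[ℂ] H}, IsUnitaryGroupGeneratedBy A W → ∀ φ ψ : H,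
      (φ, ψ) ∈ A.graph ↔ Tendsto (generatorQuotient W φ) (𝓝[≠] 0) (𝓝 ψ) := fun hW φ ψ => by
    rw [← hW.generator_eq]
    exact mem_graph_generator_iff
  have hinner : ∀ t, ∀ φ ∈ A.domain, ∀ χ ∈ A.domain, ⟪U t φ, V t χ⟫_ℂ = ⟪φ, χ⟫_ℂ := by
    intro t φ hφ χ hχ
    have tU := (hlim hU _ _).1 (A.mem_graph ⟨φ, hφ⟩)
    have tV := (hlim hV _ _).1 (A.mem_graph ⟨χ, hχ⟩)
    have hd : ∀ s, HasDerivAt (fun s => ⟪U s φ, V s χ⟫_ℂ) 0 s := fun s => by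
      refine ((gU.hasDerivAt tU s).inner ℂ (gV.hasDerivAt tV s)).congr_deriv ?_
      -- V s χ stays in the domain of the common generator A, so its limit along V is also its limit
      -- along U.
      have := gU.inner_generator_symm (gU.tendsto_generatorQuotient_map tU s)
        ((hlim hU _ _).1 ((hlim hV _ _).2 (gV.tendsto_generatorQuotient_map tV s)))
      simp only [inner_smul_left, inner_smul_right, map_neg, Complex.conj_I, neg_neg, this]
      ring
    simpa [hU.map_zero, hV.map_zero] using is_const_of_deriv_eq_zero
      (fun s => (hd s).differentiableAt) (fun s => (hd s).deriv) t 0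
  funext t
  refine ContinuousLinearMap.ext_on
    (hA.mono (Submodule.subset_span (R := ℂ))) fun χ hχ => ?_
  have hstar : star (U t) (V t χ) = χ := by
    refine hA.eq_of_inner_right ℂ fun φ hφ => ?_
    rw [ContinuousLinearMap.star_eq_adjoint, ContinuousLinearMap.adjoint_inner_right,
      hinner t φ hφ χ hχ]
  rw [← hstar, ← mul_apply_eq_comp, (Unitary.mem_iff.1 (hU.mem_unitary t)).2, hstar]
  rfl

/-- Uniqueness of the group removes the dependence of `expNegI` on the choice in its definition. -/
theorem expNegI_eq {A : H →ₗ.[ℂ] H} (hA : Dense (A.domain : Set H)) {U : ℝ → H →L[ℂ] H}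
    (hU : IsUnitaryGroupGeneratedBy A U) : expNegI A = U 1 := by
  have h : ∃ U, IsUnitaryGroupGeneratedBy A U := ⟨U, hU⟩
  rw [expNegI, dif_pos h, IsUnitaryGroupGeneratedBy.unique hA (Classical.choose_spec h) hU]

end UnitaryGroups

end WeylCalculus

end

noncomputable section

namespace WeylCalculus

/-! ### Explicit Weyl operators on L². -/

section Translations

variable {d : ℕ}

/-- The Weyl translate `x ↦ e^{-iη·(x + (ε/2) y)} f(x + ε y)` of a function on `ℝ^d`. -/
def weylTranslate (ε : ℝ) (Y : PhaseSpace d) (f : Config d → ℂ) (x : Config d) : ℂ :=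
  Complex.exp (-Complex.I * (⟪Y.2, x + (ε / 2) • Y.1⟫_ℝ : ℂ)) * f (x + ε • Y.1)

theorem norm_exp_neg_I_mul_ofReal (t : ℝ) : ‖Complex.exp (-Complex.I * t)‖ = 1 := by
  rw [← Complex.norm_exp_ofReal_mul_I (-t)]
  congr 2
  push_cast
  ring

theorem norm_weylTranslate (ε : ℝ) (Y : PhaseSpace d) (f : Config d → ℂ) (x : Config d) :
    ‖weylTranslate ε Y f x‖ = ‖f (x + ε • Y.1)‖ := by
  rw [weylTranslate, norm_mul, norm_exp_neg_I_mul_ofReal, one_mul]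

theorem weylTranslate_zero (ε : ℝ) (f : Config d → ℂ) : weylTranslate ε 0 f = f := by
  funext x
  simp [weylTranslate]

theorem weylTranslate_weylTranslate (ε : ℝ) (Y Z : PhaseSpace d) (f : Config d → ℂ)
    (x : Config d) : weylTranslate ε Y (weylTranslate ε Z f) x =
      Complex.exp (Complex.I * ((ε / 2 : ℝ) : ℂ) * (sympl Y Z : ℂ)) *
        weylTranslate ε (Y + Z) f x := by
  simp only [weylTranslate, ← mul_assoc, ← Complex.exp_add, Prod.fst_add, Prod.snd_add]
  congr 1
  · congr 1
    rw [mul_assoc Complex.I, ← Complex.ofReal_mul, neg_mul, neg_mul, neg_mul, ← neg_add,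
      ← mul_add, ← Complex.ofReal_add, ← sub_eq_add_neg, ← mul_sub, ← Complex.ofReal_sub,
      ← mul_neg, ← Complex.ofReal_neg]
    congr 2
    simp only [sympl, inner_add_left, inner_add_right, inner_smul_right]
    rw [real_inner_comm Y.1 Z.2]
    ring
  · congr 1
    rw [smul_add, add_assoc]

theorem measurePreserving_add_const (a : Config d) :
    MeasurePreserving (fun x : Config d => x + a) volume volume :=
  measurePreserving_add_right volume a

theorem memLp_weylTranslate (ε : ℝ) (Y : PhaseSpace d) {f : Config d → ℂ}
    (hf : MemLp f 2 volume) : MemLp (weylTranslate ε Y f) 2 volume := by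
  have h := hf.comp_measurePreserving (measurePreserving_add_const (ε • Y.1))
  refine (memLp_congr_norm ?_ h.1 (Eventually.of_forall (norm_weylTranslate ε Y f))).2 h
  exact AEStronglyMeasurable.mul (by fun_prop) h.1

theorem weylTranslate_congr_ae (ε : ℝ) (Y : PhaseSpace d) {f g : Config d → ℂ}
    (h : f =ᵐ[volume] g) : weylTranslate ε Y f =ᵐ[volume] weylTranslate ε Y g := by
  filter_upwards [(measurePreserving_add_const (ε • Y.1)).quasiMeasurePreserving.ae_eq_comp h]
    with x hx
  simp only [Function.comp_apply] at hx
  rw [weylTranslate, weylTranslate, hx]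

/-- The Weyl translation as an isometry of `L²(ℝ^d)`. -/
def weylIsometry (ε : ℝ) (Y : PhaseSpace d) : L2 d →ₗᵢ[ℂ] L2 d where
  toFun φ := (memLp_weylTranslate ε Y (Lp.memLp φ)).toLp _
  map_add' φ χ := by
    rw [← MemLp.toLp_add]
    refine MemLp.toLp_congr _ _ ((weylTranslate_congr_ae ε Y (Lp.coeFn_add φ χ)).trans ?_)
    exact Eventually.of_forall fun x => mul_add _ _ _
  map_smul' c φ := by
    rw [RingHom.id_apply, ← MemLp.toLp_const_smul]
    refine MemLp.toLp_congr _ _ ((weylTranslate_congr_ae ε Y (Lp.coeFn_smul c φ)).trans ?_)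
    exact Eventually.of_forall fun x => mul_left_comm _ _ _
  norm_map' φ := by
    change ‖(memLp_weylTranslate ε Y (Lp.memLp φ)).toLp _‖ = _
    rw [Lp.norm_toLp, Lp.norm_def,
      eLpNorm_congr_norm_ae (Eventually.of_forall (norm_weylTranslate ε Y φ))]
    congr 1
    exact eLpNorm_comp_measurePreserving (Lp.aestronglyMeasurable φ)
      (measurePreserving_add_const (ε • Y.1))

/-- The Weyl translation as a bounded operator on `L²(ℝ^d)`. -/
def weylOperator (ε : ℝ) (Y : PhaseSpace d) : L2 d →L[ℂ] L2 d :=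
  (weylIsometry ε Y).toContinuousLinearMap

theorem coeFn_weylOperator (ε : ℝ) (Y : PhaseSpace d) (φ : L2 d) :
    weylOperator ε Y φ =ᵐ[volume] weylTranslate ε Y φ :=
  (memLp_weylTranslate ε Y (Lp.memLp φ)).coeFn_toLp

theorem norm_weylOperator (ε : ℝ) (Y : PhaseSpace d) (φ : L2 d) :
    ‖weylOperator ε Y φ‖ = ‖φ‖ :=
  (weylIsometry ε Y).norm_map φ

theorem weylOperator_mul (ε : ℝ) (Y Z : PhaseSpace d) :
    weylOperator ε Y * weylOperator ε Z =
      Complex.exp (Complex.I * ((ε / 2 : ℝ) : ℂ) * (sympl Y Z : ℂ)) • weylOperator ε (Y + Z) := by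
  ext1 φ
  refine Lp.ext ?_
  refine ((coeFn_weylOperator ε Y _).trans
    (weylTranslate_congr_ae ε Y (coeFn_weylOperator ε Z φ))).trans ?_
  refine EventuallyEq.trans ?_ (Lp.coeFn_smul _ (weylOperator ε (Y + Z) φ)).symm
  filter_upwards [coeFn_weylOperator ε (Y + Z) φ] with x hx
  rw [weylTranslate_weylTranslate, Pi.smul_apply, hx, smul_eq_mul]

theorem weylOperator_zero (ε : ℝ) : weylOperator ε (0 : PhaseSpace d) = 1 := by
  ext1 φ
  refine Lp.ext ((coeFn_weylOperator ε 0 φ).trans ?_)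
  rw [weylTranslate_zero]
  rfl

theorem sympl_smul_smul (s t : ℝ) (Y : PhaseSpace d) : sympl (s • Y) (t • Y) = 0 := by
  simp only [sympl, Prod.smul_fst, Prod.smul_snd, inner_smul_left, inner_smul_right]
  rw [real_inner_comm Y.1 Y.2]
  simp [mul_left_comm]

theorem weylOperator_smul_mul (ε s t : ℝ) (Y : PhaseSpace d) :
    weylOperator ε (s • Y) * weylOperator ε (t • Y) = weylOperator ε ((s + t) • Y) := by
  rw [weylOperator_mul, sympl_smul_smul, add_smul]
  simp

theorem weylOperator_mem_unitary (ε : ℝ) (Y : PhaseSpace d) :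
    weylOperator ε Y ∈ unitary (L2 d →L[ℂ] L2 d) := by
  have hl : star (weylOperator ε Y) * weylOperator ε Y = 1 := by
    rw [ContinuousLinearMap.star_eq_adjoint]
    exact (ContinuousLinearMap.norm_map_iff_adjoint_comp_self _).1 (norm_weylOperator ε Y)
  -- An isometry has its adjoint as left inverse; a right inverse makes it unitary.
  have hr : weylOperator ε Y * weylOperator ε (-Y) = 1 := by
    have := weylOperator_smul_mul ε 1 (-1) Y
    simpa [weylOperator_zero] using this
  refine Unitary.mem_iff.2 ⟨hl, ?_⟩
  rwa [left_inv_eq_right_inv hl hr]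

theorem isUnitaryGroup_weylOperator (ε : ℝ) (Y : PhaseSpace d) :
    IsUnitaryGroup fun t : ℝ => weylOperator ε (t • Y) where
  map_zero := by simp [weylOperator_zero]
  map_add s t := (weylOperator_smul_mul ε s t Y).symm
  mem_unitary t := weylOperator_mem_unitary ε (t • Y)

end Translations

/-! ### Dominated convergence in L². -/

section DominatedConvergence

variable {d : ℕ}

/-- A square-integrable weight dominating Schwartz functions. -/
def decayWeight (x : Config d) : ℝ := ((1 + ‖x‖) ^ (d + 1))⁻¹

theorem integrable_decayWeight_sq : Integrable (fun x : Config d => decayWeight x ^ 2) := by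
  have h := integrable_one_add_norm (E := Config d) (μ := volume) (r := 2 * (d + 1))
    (by simp; linarith [(Nat.cast_nonneg d : (0 : ℝ) ≤ d)])
  refine h.congr (Eventually.of_forall fun x => ?_)
  change (1 + ‖x‖) ^ (-(2 * ((d : ℝ) + 1))) = (((1 + ‖x‖) ^ (d + 1))⁻¹) ^ 2
  rw [Real.rpow_neg (by positivity), inv_pow, ← pow_mul, ← Real.rpow_natCast]
  push_cast
  rw [mul_comm]

theorem tendsto_of_dominated_by_decayWeight {ι : Type*} {l : Filter ι} [l.IsCountablyGenerated]
    {F : ι → L2 d} {G : L2 d} {f : ι → Config d → ℂ} {g : Config d → ℂ}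
    (hF : ∀ i, F i =ᵐ[volume] f i) (hG : G =ᵐ[volume] g) {C : ℝ}
    (hf : ∀ᶠ i in l, ∀ x, ‖f i x‖ ≤ C * decayWeight x) (hg : ∀ x, ‖g x‖ ≤ C * decayWeight x)
    (hlim : ∀ x, Tendsto (fun i => f i x) l (𝓝 (g x))) : Tendsto F l (𝓝 G) := by
  have hsq : ∀ i, ‖F i - G‖ ^ 2 = ∫ x, ‖f i x - g x‖ ^ 2 := fun i => by
    rw [← inner_self_eq_norm_sq (𝕜 := ℂ), L2.inner_def, ← integral_re (L2.integrable_inner _ _)]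
    refine integral_congr_ae ?_
    filter_upwards [Lp.coeFn_sub (F i) G, hF i, hG] with x hx hfx hgx
    rw [inner_self_eq_norm_sq, hx, Pi.sub_apply, hfx, hgx]
  have hint : Tendsto (fun i => ∫ x, ‖f i x - g x‖ ^ 2) l (𝓝 (∫ _ : Config d, (0 : ℝ))) := by
    refine tendsto_integral_filter_of_dominated_convergence
      (fun x => (2 * C) ^ 2 * decayWeight x ^ 2) (Eventually.of_forall fun i => ?_) ?_
      (integrable_decayWeight_sq.const_mul _) (Eventually.of_forall fun x => ?_)
    · exact ((((Lp.aestronglyMeasurable (F i)).congr (hF i)).sub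
        ((Lp.aestronglyMeasurable G).congr hG)).norm.pow 2)
    · filter_upwards [hf] with i hi
      refine Eventually.of_forall fun x => ?_
      rw [Real.norm_of_nonneg (by positivity), ← mul_pow]
      gcongr
      calc ‖f i x - g x‖ ≤ ‖f i x‖ + ‖g x‖ := norm_sub_le _ _
        _ ≤ 2 * C * decayWeight x := by linarith [hi x, hg x]
    · simpa using ((hlim x).sub_const (g x)).norm.pow 2
  rw [tendsto_iff_norm_sub_tendsto_zero]
  have := hint.congr fun i => (hsq i).symm
  rw [integral_zero] at this
  simpa [Function.comp_def, Real.sqrt_sq (norm_nonneg _)] using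
    (Real.continuous_sqrt.tendsto 0).comp this

/-- Peetre's inequality 1 + ‖x‖ ≤ (1 + R)(1 + ‖x + a‖) makes Schwartz decay uniform over bounded
translations. -/
theorem exists_norm_add_le_decayWeight (φ : 𝓢(Config d, ℂ)) (R : ℝ) :
    ∃ C, ∀ a : Config d, ‖a‖ ≤ R → ∀ x, ‖φ (x + a)‖ ≤ C * decayWeight x := by
  let M : ℝ := 2 ^ (d + 1) *
    (Finset.Iic (d + 1, 0)).sup (fun m => SchwartzMap.seminorm ℝ m.1 m.2) φ
  have hM : ∀ x, (1 + ‖x‖) ^ (d + 1) * ‖φ x‖ ≤ M := fun x => by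
    have := SchwartzMap.one_add_le_sup_seminorm_apply (𝕜 := ℝ) (m := (d + 1, 0)) le_rfl le_rfl φ x
    simpa only [norm_iteratedFDeriv_zero] using this
  refine ⟨(1 + R) ^ (d + 1) * M, fun a ha x => ?_⟩
  have hR : 0 ≤ R := (norm_nonneg a).trans ha
  have hx : 1 + ‖x‖ ≤ (1 + R) * (1 + ‖x + a‖) := by
    have : ‖x‖ ≤ ‖x + a‖ + ‖a‖ := by simpa using norm_sub_le (x + a) a
    nlinarith [mul_nonneg hR (norm_nonneg (x + a))]
  rw [decayWeight, ← div_eq_mul_inv, le_div_iff₀ (by positivity), mul_comm]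
  calc (1 + ‖x‖) ^ (d + 1) * ‖φ (x + a)‖
      ≤ ((1 + R) * (1 + ‖x + a‖)) ^ (d + 1) * ‖φ (x + a)‖ := by gcongr
    _ = (1 + R) ^ (d + 1) * ((1 + ‖x + a‖) ^ (d + 1) * ‖φ (x + a)‖) := by
        rw [mul_pow, mul_assoc]
    _ ≤ (1 + R) ^ (d + 1) * M := by gcongr; exact hM _

end DominatedConvergence

/-! ### Schwartz functions as an invariant core. -/

section Schwartz

variable {d : ℕ}

theorem coeFn_schwartzToL2 (φ : 𝓢(Config d, ℂ)) : schwartzToL2 d φ =ᵐ[volume] φ :=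
  φ.coeFn_toLp 2 volume

theorem dense_range_schwartzToL2 : Dense (LinearMap.range (schwartzToL2 d) : Set (L2 d)) :=
  SchwartzMap.denseRange_toLpCLM (F := ℂ) (μ := (volume : Measure (Config d)))
    ENNReal.ofNat_ne_top

theorem continuous_weylTranslate (ε : ℝ) (φ : 𝓢(Config d, ℂ)) (x : Config d) :
    Continuous fun Y : PhaseSpace d => weylTranslate ε Y φ x := by
  unfold weylTranslate
  have := φ.continuous
  fun_prop

theorem continuous_weylOperator_schwartzToL2 (ε : ℝ) (φ : 𝓢(Config d, ℂ)) :
    Continuous fun Y : PhaseSpace d => weylOperator ε Y (schwartzToL2 d φ) := by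
  refine continuous_iff_continuousAt.2 fun Y₀ => ?_
  obtain ⟨C, hC⟩ := exists_norm_add_le_decayWeight φ (‖ε • Y₀.1‖ + 1)
  have hev : ∀ᶠ Y : PhaseSpace d in 𝓝 Y₀, ‖ε • Y.1‖ < ‖ε • Y₀.1‖ + 1 :=
    ContinuousAt.eventually_lt (by fun_prop) continuousAt_const (by simp)
  refine tendsto_of_dominated_by_decayWeight (C := C)
    (fun Y => (coeFn_weylOperator ε Y _).trans
      (weylTranslate_congr_ae ε Y (coeFn_schwartzToL2 φ)))
    ((coeFn_weylOperator ε Y₀ _).trans (weylTranslate_congr_ae ε Y₀ (coeFn_schwartzToL2 φ)))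
    ?_ (fun x => ?_) fun x => (continuous_weylTranslate ε φ x).tendsto Y₀
  · filter_upwards [hev] with Y hY x
    rw [norm_weylTranslate]
    exact hC _ hY.le x
  · rw [norm_weylTranslate]
    exact hC _ (by simp) x

theorem continuous_weylOperator (ε : ℝ) (φ : L2 d) :
    Continuous fun Y : PhaseSpace d => weylOperator ε Y φ := by
  -- The operators are isometries, so approximating φ by a Schwartz function is uniform in Y.
  refine continuous_of_uniform_approx_of_continuous fun u hu => ?_
  obtain ⟨δ, hδ, hu⟩ := Metric.mem_uniformity_dist.1 hu
  obtain ⟨_, hχ, ⟨χ, rfl⟩⟩ := Metric.dense_iff.1 dense_range_schwartzToL2 φ δ hδ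
  refine ⟨_, continuous_weylOperator_schwartzToL2 ε χ, fun Y => hu ?_⟩
  rw [dist_eq_norm, ← map_sub, norm_weylOperator, ← dist_eq_norm, dist_comm]
  exact hχ

theorem iteratedDeriv_exp_neg_I_mul (n : ℕ) :
    iteratedDeriv n (fun t : ℝ => Complex.exp (-Complex.I * t)) =
      fun t : ℝ => (-Complex.I) ^ n * Complex.exp (-Complex.I * t) := by
  induction n with
  | zero => simp
  | succ n ih =>
    rw [iteratedDeriv_succ, ih]
    funext t
    have h : HasDerivAt (fun s : ℝ => Complex.exp (-Complex.I * s))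
        (Complex.exp (-Complex.I * t) * (-Complex.I * 1)) t :=
      ((hasDerivAt_id (t : ℂ)).const_mul (-Complex.I)).cexp.comp_ofReal
    rw [(h.const_mul _).deriv]
    ring

theorem hasTemperateGrowth_exp_neg_I_mul :
    (fun t : ℝ => Complex.exp (-Complex.I * t)).HasTemperateGrowth := by
  -- Every derivative of e^{-it} has modulus 1, hence degree 0 and constant 1.
  refine ⟨?_, fun n => ⟨0, 1, fun t => ?_⟩⟩
  · exact (contDiff_const.mul Complex.ofRealCLM.contDiff).cexp
  · rw [norm_iteratedFDeriv_eq_norm_iteratedDeriv, iteratedDeriv_exp_neg_I_mul, norm_mul,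
      norm_exp_neg_I_mul_ofReal]
    simp

/-- The invariance needed for the core criterion: translations preserve Schwartz functions, and so
does a phase of temperate growth. -/
theorem weylOperator_mem_range_schwartzToL2 (ε : ℝ) (Y : PhaseSpace d) (φ : 𝓢(Config d, ℂ)) :
    weylOperator ε Y (schwartzToL2 d φ) ∈ LinearMap.range (schwartzToL2 d) := by
  have hphase : (fun x : Config d =>
      Complex.exp (-Complex.I * (⟪Y.2, x + (ε / 2) • Y.1⟫_ℝ : ℂ))).HasTemperateGrowth := by
    have h : (fun x : Config d => ⟪Y.2, x + (ε / 2) • Y.1⟫_ℝ).HasTemperateGrowth := by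
      simp only [inner_add_right]
      exact (Function.hasTemperateGrowth_inner_right Y.2).add (.const _)
    exact hasTemperateGrowth_exp_neg_I_mul.comp h
  refine ⟨SchwartzMap.smulLeftCLM ℂ (fun x : Config d =>
      Complex.exp (-Complex.I * (⟪Y.2, x + (ε / 2) • Y.1⟫_ℝ : ℂ)))
    (φ.compSubConstCLM ℂ (-(ε • Y.1))), Lp.ext ?_⟩
  refine (coeFn_schwartzToL2 _).trans (((coeFn_weylOperator ε Y _).trans
    (weylTranslate_congr_ae ε Y (coeFn_schwartzToL2 φ))).trans ?_).symm
  refine Eventually.of_forall fun x => ?_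
  rw [SchwartzMap.smulLeftCLM_apply_apply hphase, SchwartzMap.compSubConstCLM_apply, sub_neg_eq_add]
  rfl

theorem symplQP_apply (ε : ℝ) (X : PhaseSpace d) (φ : 𝓢(Config d, ℂ)) (x : Config d) :
    symplQP ε X φ x = (⟪X.2, x⟫_ℝ : ℂ) * φ x + Complex.I * ε * fderiv ℝ φ x X.1 := by
  have hX : fderiv ℝ φ x X.1 =
      ∑ l, (X.1 l : ℂ) * fderiv ℝ φ x (EuclideanSpace.single l (1 : ℝ)) := by
    conv_lhs => rw [← (EuclideanSpace.basisFun (Fin d) ℝ).sum_repr X.1]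
    simp [map_sum]
  have hin : (⟪X.2, x⟫_ℝ : ℂ) = ∑ l, (X.2 l : ℂ) * (x l : ℂ) := by
    rw [PiLp.inner_apply]
    push_cast
    exact Finset.sum_congr rfl fun l _ => by simp [mul_comm]
  rw [hX, hin, Finset.sum_mul, Finset.mul_sum, ← Finset.sum_add_distrib, symplQP,
    LinearMap.sum_apply, _root_.sum_apply]
  refine Finset.sum_congr rfl fun l _ => ?_
  rw [LinearMap.sub_apply, LinearMap.smul_apply, LinearMap.smul_apply, _root_.sub_apply,
    _root_.smul_apply, _root_.smul_apply, position_apply, momentum_apply, smul_eq_mul,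
    smul_eq_mul]
  ring

theorem hasDerivAt_weylTranslate (ε : ℝ) (Y : PhaseSpace d) (φ : 𝓢(Config d, ℂ)) (x : Config d)
    (t : ℝ) : HasDerivAt (fun s : ℝ => weylTranslate ε (s • Y) φ x)
      (-Complex.I * weylTranslate ε (t • Y) (symplQP ε Y φ) x) t := by
  -- The phase is quadratic in s; the factor ε/2 makes its derivative η·(x + εsy), that is, η paired
  -- with the translated point.
  have hin : ∀ s : ℝ, ⟪(s • Y).2, x + (ε / 2) • (s • Y).1⟫_ℝ =
      s * ⟪Y.2, x⟫_ℝ + ε / 2 * ⟪Y.2, Y.1⟫_ℝ * s ^ 2 := fun s => by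
    simp only [Prod.smul_fst, Prod.smul_snd, inner_add_right, real_inner_smul_left,
      real_inner_smul_right]
    ring
  have h1 : HasDerivAt (fun s : ℝ => ⟪(s • Y).2, x + (ε / 2) • (s • Y).1⟫_ℝ)
      ⟪Y.2, x + ε • t • Y.1⟫_ℝ t := by
    simp only [hin]
    refine (((hasDerivAt_id t).mul_const _).add ((hasDerivAt_pow 2 t).const_mul _)).congr_deriv ?_
    simp only [inner_add_right, real_inner_smul_right]
    push_cast
    ring
  have h2 : HasDerivAt (fun s : ℝ => φ (x + ε • (s • Y).1))
      (fderiv ℝ φ (x + ε • t • Y.1) (ε • Y.1)) t := by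
    have ha : HasDerivAt (fun s : ℝ => x + ε • (s • Y).1) (ε • Y.1) t := by
      simpa using ((((hasDerivAt_id t).smul_const Y.1).const_smul ε).const_add x)
    exact (φ.differentiableAt.hasFDerivAt).comp_hasDerivAt t ha
  refine (((h1.ofReal_comp.const_mul (-Complex.I)).cexp).mul h2).congr_deriv ?_
  simp only [weylTranslate, symplQP_apply, Prod.smul_fst, map_smul]
  rw [RCLike.real_smul_eq_coe_mul (K := ℂ)]
  simp only [Complex.coe_algebraMap]
  linear_combination (Complex.exp (-Complex.I * (⟪(t • Y).2, x + (ε / 2) • t • Y.1⟫_ℝ : ℂ)) * ε *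
    fderiv ℝ φ (x + ε • t • Y.1) Y.1) * Complex.I_mul_I

theorem tendsto_generatorQuotient_weylOperator (ε : ℝ) (Y : PhaseSpace d) (φ : 𝓢(Config d, ℂ)) :
    Tendsto (generatorQuotient (fun t : ℝ => weylOperator ε (t • Y)) (schwartzToL2 d φ)) (𝓝[≠] 0)
      (𝓝 (schwartzToL2 d (symplQP ε Y φ))) := by
  obtain ⟨C, hC⟩ := exists_norm_add_le_decayWeight (symplQP ε Y φ) ‖ε • Y.1‖
  have hbound : ∀ t : ℝ, ‖t‖ ≤ 1 → ∀ x,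
      ‖weylTranslate ε (t • Y) (symplQP ε Y φ) x‖ ≤ C * decayWeight x := fun t ht x => by
    rw [norm_weylTranslate]
    refine hC _ ?_ x
    rw [Prod.smul_fst, smul_comm, norm_smul]
    exact mul_le_of_le_one_left (norm_nonneg _) ht
  refine tendsto_of_dominated_by_decayWeight (C := C)
    (f := fun t x => (Complex.I / (t : ℂ)) * (weylTranslate ε (t • Y) φ x - φ x))
    (fun t => ?_) (coeFn_schwartzToL2 _) ?_ (fun x => ?_) (fun x => ?_)
  · refine (Lp.coeFn_smul _ _).trans ?_
    filter_upwards [Lp.coeFn_sub (weylOperator ε (t • Y) (schwartzToL2 d φ)) (schwartzToL2 d φ),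
      (coeFn_weylOperator ε (t • Y) _).trans
        (weylTranslate_congr_ae ε (t • Y) (coeFn_schwartzToL2 φ)), coeFn_schwartzToL2 φ]
      with x h1 h2 h3
    rw [Pi.smul_apply, h1, Pi.sub_apply, h2, h3, smul_eq_mul]
  · have hev : ∀ᶠ t : ℝ in 𝓝[≠] 0, t ∈ Metric.closedBall (0 : ℝ) 1 ∧ t ≠ 0 :=
      inter_mem (mem_nhdsWithin_of_mem_nhds (Metric.closedBall_mem_nhds (0 : ℝ) one_pos))
        self_mem_nhdsWithin
    filter_upwards [hev] with t ht x
    -- The mean value inequality turns the bound on the derivative for |s| ≤ 1 into a dominating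
    -- function for the difference quotients.
    have := (convex_closedBall (0 : ℝ) 1).norm_image_sub_le_of_norm_hasDerivWithin_le
      (f := fun s : ℝ => weylTranslate ε (s • Y) φ x) (C := C * decayWeight x)
      (fun s _ => (hasDerivAt_weylTranslate ε Y φ x s).hasDerivWithinAt)
      (fun s hs => by
        rw [norm_mul, norm_neg, Complex.norm_I, one_mul]
        exact hbound s (by simpa using hs) x)
      (Metric.mem_closedBall_self zero_le_one) ht.1
    simp only [zero_smul, weylTranslate_zero, sub_zero] at this
    rw [norm_mul, norm_div, Complex.norm_I, Complex.norm_real, one_div, inv_mul_le_iff₀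
      (norm_pos_iff.2 ht.2), mul_comm]
    exact this
  · simpa using hC 0 (by simp) x
  · have h := hasDerivAt_iff_tendsto_slope_zero.1 (hasDerivAt_weylTranslate ε Y φ x 0)
    have h' := h.const_mul Complex.I
    simp only [zero_add, zero_smul, weylTranslate_zero, ← mul_assoc, mul_neg, Complex.I_mul_I,
      neg_neg, one_mul] at h'
    refine h'.congr fun t => ?_
    rw [RCLike.real_smul_eq_coe_mul (K := ℂ), ← mul_assoc]
    simp [div_eq_mul_inv]

theorem isSelfAdjoint_weylGenerator (ε : ℝ) (X : PhaseSpace d) :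
    IsSelfAdjoint (weylGenerator ε X) ∧
      IsUnitaryGroupGeneratedBy (weylGenerator ε X) fun t : ℝ => weylOperator ε (t • X) := by
  have hU := isUnitaryGroup_weylOperator ε X
  have hT : ∀ φ : (onSchwartz (symplQP ε X)).domain,
      Tendsto (generatorQuotient (fun t : ℝ => weylOperator ε (t • X)) (φ : L2 d)) (𝓝[≠] 0)
        (𝓝 (onSchwartz (symplQP ε X) φ)) := by
    rintro ⟨_, ⟨φ, rfl⟩⟩
    rw [onSchwartz_apply]
    exact tendsto_generatorQuotient_weylOperator ε X φ
  have hinv : ∀ t : ℝ, ∀ φ ∈ (onSchwartz (symplQP ε X)).domain,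
      weylOperator ε (t • X) φ ∈ (onSchwartz (symplQP ε X)).domain := by
    rintro t _ ⟨φ, rfl⟩
    exact weylOperator_mem_range_schwartzToL2 ε (t • X) φ
  exact ⟨hU.isSelfAdjoint_closure dense_range_schwartzToL2 hT hinv, hU.map_zero, hU.map_add,
    hU.mem_unitary, fun φ => (continuous_weylOperator ε φ).comp (by fun_prop),
    hU.generator_eq_closure dense_range_schwartzToL2 hT hinv⟩

theorem weylSystem_eq_weylOperator (ε : ℝ) (X : PhaseSpace d) :
    weylSystem ε X = weylOperator ε X := by
  obtain ⟨hA, hU⟩ := isSelfAdjoint_weylGenerator ε X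
  rw [weylSystem, expNegI_eq hA.dense_domain hU, one_smul]

end Schwartz

end WeylCalculus

end

/-! ### The Weyl system. -/

open WeylCalculus in
theorem mainTheorem7 (d : ℕ) (ε : ℝ) :
    -- `ξ · Q - x · P` is essentially selfadjoint on the Schwartz functions, its closure generates
    -- exactly one unitary group, and `W(X)` is the value of that group at time `1`
    (∀ X : PhaseSpace d,
      IsSelfAdjoint (weylGenerator ε X) ∧
      (∃! U : ℝ → L2 d →L[ℂ] L2 d, IsUnitaryGroupGeneratedBy (weylGenerator ε X) U) ∧
      ∀ U : ℝ → L2 d →L[ℂ] L2 d, IsUnitaryGroupGeneratedBy (weylGenerator ε X) U →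
        weylSystem ε X = U 1) ∧
    -- explicit action on wave functions
    (∀ (Y : PhaseSpace d) (φ : L2 d),
      (weylSystem ε Y φ : Config d → ℂ) =ᵐ[volume] fun x =>
        Complex.exp (-Complex.I * (⟪Y.2, x + (ε / 2) • Y.1⟫_ℝ : ℂ)) * φ (x + ε • Y.1)) ∧
    -- strong continuity
    (∀ φ : L2 d, Continuous fun Y : PhaseSpace d => weylSystem ε Y φ) ∧
    -- composition law
    (∀ Y Z : PhaseSpace d,
      weylSystem ε Y * weylSystem ε Z =
        Complex.exp (Complex.I * ((ε / 2 : ℝ) : ℂ) * (sympl Y Z : ℂ)) •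
          weylSystem ε (Y + Z)) := by
  refine ⟨fun X => ?_, fun Y φ => ?_, fun φ => ?_, fun Y Z => ?_⟩
  · obtain ⟨hA, hU⟩ := isSelfAdjoint_weylGenerator ε X
    exact ⟨hA, ⟨_, hU, fun V hV => hV.unique hA.dense_domain hU⟩,
      fun V hV => expNegI_eq hA.dense_domain hV⟩
  · rw [weylSystem_eq_weylOperator]
    exact coeFn_weylOperator ε Y φ
  · simpa only [weylSystem_eq_weylOperator] using continuous_weylOperator ε φ
  · simpa only [weylSystem_eq_weylOperator] using weylOperator_mul ε Y Z
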